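/- Words are finite sequences of letters. A word $u=u_1\cdots u_m$ has period $p\ge 1$ if $u_i=u_{i+p}$ for all $1\le i\le m-p$, and its shortest period is the least such $p$. A run in a word $u$ is an interval $[i..j]$ of positions, $1\le i\le j\le |u|$, such that the factor $u[i..j]=u_i\cdots u_j$ has shortest period $p$ with $2p\le j-i+1$, and such that $u_{i-1}\ne u_{i+p-1}$ if $i>1$ and $u_{j+1-p}\ne u_{j+1}$ if $j<|u|$. A highly periodic run (hp-run) is a run $[i..j]$ whose factor has shortest period $p$ with $3p\le j-i+1$. Let $X=(a^3b^3)^3$, $Y=a^4b^3a$, $\alpha=XY$ and $\beta=Xa$, which are words over $\{a,b\}$. Let $h$ be the Fibonacci morphism on words over the alphabet $\{\alpha,\beta\}$, given by $h(\alpha)=\alpha\beta$ and $h(\beta)=\alpha$. For $n\ge 0$ let $f_n=h^n(\alpha)$, read as a word over $\{a,b\}$, let $r_n$ be the number of hp-runs of $f_n$, and let $\ell_n=|f_n|$ be its length over $\{a,b\}$. **Theorem.** The limit $\lim_{n\to\infty} r_n/\ell_n$ exists and $$\lim_{n\to\infty}\frac{r_n}{\ell_n}>0.406 .$$ Moreover,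 $$\frac{r_{19}}{\ell_{19}}\ge\frac{103664}{255329}>0.406 .$$ -/

import Mathlib

open Filter Topology

namespace HPRuns

section Runs

variable {A : Type*}

/-- The factor `u[i..j]` of `u`; positions are counted from `0` and both ends are included. -/
def factor (u : List A) (i j : ℕ) : List A := (u.drop i).take (j + 1 - i)

/-- The shortest period of the word `u`: the least positive `p` such that `u` has period `p`. -/
noncomputable def per (u : List A) : ℕ := sInf {p : ℕ | 0 < p ∧ u.HasPeriod p}

/-- `[i..j]` is a run of `u`: an interval of positions of `u` whose factor has shortest period `p`
with `2 * p ≤ j - i + 1`, and which cannot be extended, with the period `p`, by one letter to the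
left or to the right. -/
structure IsRun (u : List A) (i j : ℕ) : Prop where
  le : i ≤ j
  lt_length : j < u.length
  two_mul_per_le : 2 * per (factor u i j) ≤ j - i + 1
  left_maximal : 0 < i → u[i - 1]? ≠ u[i - 1 + per (factor u i j)]?
  right_maximal : j + 1 < u.length → u[j + 1 - per (factor u i j)]? ≠ u[j + 1]?

/-- `[i..j]` is a highly periodic run of `u`: a run whose shortest period `p` satisfies
`3 * p ≤ j - i + 1`. -/
def IsHPRun (u : List A) (i j : ℕ) : Prop :=
  IsRun u i j ∧ 3 * per (factor u i j) ≤ j - i + 1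

/-- A word has only finitely many hp-runs, so that counting them with `Set.ncard` is meaningful. -/
theorem finite_setOf_isHPRun (u : List A) : {q : ℕ × ℕ | IsHPRun u q.1 q.2}.Finite := by
  refine ((Set.finite_Iio u.length).prod (Set.finite_Iio u.length)).subset ?_
  rintro ⟨i, j⟩ ⟨h, -⟩
  exact ⟨lt_of_le_of_lt h.le h.lt_length, h.lt_length⟩

/-- The number of hp-runs of the word `u`. -/
noncomputable def hpRuns (u : List A) : ℕ := {q : ℕ × ℕ | IsHPRun u q.1 q.2}.ncard

end Runs

/-- The alphabet `{a, b}`. -/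
inductive Letter
  | a
  | b

/-- The alphabet `{α, β}`. -/
inductive Greek
  | α
  | β

/-- `w ^ k` for a word `w`. -/
def wpow {A : Type*} (w : List A) (k : ℕ) : List A := (List.replicate k w).flatten

/-- `X = (a³b³)³`. -/
def X : List Letter := wpow (wpow [Letter.a] 3 ++ wpow [Letter.b] 3) 3

/-- `Y = a⁴b³a`. -/
def Y : List Letter := wpow [Letter.a] 4 ++ wpow [Letter.b] 3 ++ [Letter.a]

/-- The words over `{a, b}` for which `α` and `β` stand: `α = XY` and `β = Xa`. -/
def expand : Greek → List Letter
  | Greek.α => X ++ Y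
  | Greek.β => X ++ [Letter.a]

/-- The Fibonacci morphism on letters: `α ↦ αβ`, `β ↦ α`. -/
def fibLetter : Greek → List Greek
  | Greek.α => [Greek.α, Greek.β]
  | Greek.β => [Greek.α]

/-- The Fibonacci morphism `h` on words over `{α, β}`. -/
def h (w : List Greek) : List Greek := w.flatMap fibLetter

/-- `f n = hⁿ(α)`, read as a word over `{a, b}`. -/
def f (n : ℕ) : List Letter := (h^[n] [Greek.α]).flatMap expand

/-- `r n` is the number of hp-runs of `f n`. -/
noncomputable def r (n : ℕ) : ℕ := hpRuns (f n)

/-- `ℓ n` is the length of `f n`. -/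
def ℓ (n : ℕ) : ℕ := (f n).length

end HPRuns

/-!
The word `f (n + 2)` is the concatenation of `f (n + 1)` and `f n`.

*The limit exists.* By the periodicity lemma, two hp-runs of periods `p` and `q` that overlap in
`p + q` letters are equal (`eq_of_overlap`). Since an hp-run has length at least `3 * p`, only
boundedly many hp-runs with periods of the same order of magnitude can touch a given position of a
word `u`, hence only `O(log |u|)` altogether (`ncard_touching_le`). Therefore the number of hp-runs
is additive under concatenation up to a logarithmic error, `r (n + 2)` differs from
`r (n + 1) + r n` by `O(n)`, and the densities form a Cauchy sequence (`exists_tendsto_density`).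

*The limit is large.* An interval which is maximal for some period `p` and has length at least
`3 * p` is an hp-run, whether or not `p` is its shortest period (`IsMaxPer.isHPRun`). So it suffices
to exhibit such intervals, and to tell them apart by their positions and lengths.
* Short ones (`exists_finset_local`): the powers of letters, the runs of period 6 in the factors
  `X`, and the runs of period 7 around the factors `Y` yield 10 runs for a letter `α`, or 9 if
  it is the last letter, and 7 for a letter `β`.
* Long ones (`exists_finset_long`): let `A` and `B` be the words over `{a, b}` for `h ^ k α` and
  `h ^ k β`. They have a common suffix of exactly 7 letters, and `AB` and `BA` have a common prefix
  of exactly `ℓ (k + 1) - 17` letters (`E_common`). So the square `AA` in `BAABA` extends to a run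
  of period `ℓ k` and of length `2 * ℓ k + ℓ (k + 1) - 10`. Each `α` of `h ^ (n - k - 2) α`, except
  for one among the last two letters, gives rise to a factor `BAABA` of `f n`.
* For odd `n` there is one more run, of period 26, at the end of `f n`.

Summing up over `k` gives `r n ≥ 11 * fib (n + 1) + 7 * fib n - n - 1`, and 2 more for odd `n ≥ 3`
(`r_lower_bound`), whereas `ℓ n = 26 * fib (n + 1) + 19 * fib n`.
-/

namespace HPRuns

/-! ### Maximal periodic intervals and highly periodic runs -/

section Runs

variable {A : Type*}

/-- `[i..j]` is a maximal interval of `u` with period `p`. In contrast to `IsRun`, the period `p`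
is not required to be the shortest one, and the interval need only have one full period. -/
structure IsMaxPer (u : List A) (p i j : ℕ) : Prop where
  pos : 0 < p
  le : i ≤ j
  lt_length : j < u.length
  period_le : p ≤ j - i + 1
  periodic : ∀ t, i ≤ t → t + p ≤ j → u[t]? = u[t + p]?
  left_maximal : 0 < i → u[i - 1]? ≠ u[i - 1 + p]?
  right_maximal : j + 1 < u.length → u[j + 1 - p]? ≠ u[j + 1]?

theorem length_factor {u : List A} {i j : ℕ} (hj : j < u.length) :
    (factor u i j).length = j + 1 - i := by
  simp [factor]; omega

theorem getElem?_factor {u : List A} {i j t : ℕ} (ht : t < j + 1 - i) :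
    (factor u i j)[t]? = u[i + t]? := by
  simp [factor, ht]

theorem hasPeriod_factor_iff {u : List A} {p i j : ℕ} (hj : j < u.length) :
    (factor u i j).HasPeriod p ↔ ∀ t, i ≤ t → t + p ≤ j → u[t]? = u[t + p]? := by
  rw [List.hasPeriod_iff_getElem?, length_factor hj]
  constructor
  · intro H t hit htp
    have := H (t - i) (by omega)
    rw [getElem?_factor (by omega), getElem?_factor (by omega)] at this
    rwa [show i + (t - i) = t by omega, show i + (t - i + p) = t + p by omega] at this
  · intro H t ht
    rw [getElem?_factor (by omega), getElem?_factor (by omega), ← add_assoc]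
    exact H (i + t) (by omega) (by omega)

theorem eq_add_mul_of_periodic {u : List A} {p i j : ℕ}
    (H : ∀ t, i ≤ t → t + p ≤ j → u[t]? = u[t + p]?) {t : ℕ} (ht : i ≤ t) (m : ℕ)
    (hm : t + m * p ≤ j) : u[t]? = u[t + m * p]? := by
  induction m with
  | zero => simp
  | succ m ih =>
    rw [Nat.succ_mul] at hm ⊢
    rw [ih (by omega), H (t + m * p) (by omega) (by omega), add_assoc]

theorem eq_of_modEq_of_periodic {u : List A} {p i j : ℕ}
    (H : ∀ t, i ≤ t → t + p ≤ j → u[t]? = u[t + p]?) {s t : ℕ} (hs : i ≤ s) (hsj : s ≤ j)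
    (ht : i ≤ t) (htj : t ≤ j) (hst : s ≡ t [MOD p]) : u[s]? = u[t]? := by
  wlog hle : s ≤ t generalizing s t
  · exact (this ht htj hs hsj hst.symm (by omega)).symm
  obtain ⟨m, hm⟩ := (Nat.modEq_iff_dvd' hle).mp hst
  rw [mul_comm] at hm
  have : t = s + m * p := by omega
  subst this
  exact eq_add_mul_of_periodic H hs m htj

theorem per_factor_pos_and_hasPeriod {u : List A} {i j : ℕ} (hle : i ≤ j) (hj : j < u.length) :
    0 < per (factor u i j) ∧ (factor u i j).HasPeriod (per (factor u i j)) :=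
  Nat.sInf_mem (s := {p : ℕ | 0 < p ∧ (factor u i j).HasPeriod p})
    ⟨j + 1 - i, by omega, List.hasPeriod_of_length_le _ _ (length_factor hj).le⟩

theorem per_le {w : List A} {p : ℕ} (hp : 0 < p) (H : w.HasPeriod p) : per w ≤ p :=
  Nat.sInf_le ⟨hp, H⟩

/-- By the periodicity lemma, the shortest period of a word divides each of its periods that is at
most half of its length. -/
theorem per_dvd {u : List A} {p i j : ℕ} (hp : 0 < p) (hle : i ≤ j) (hj : j < u.length)
    (H : ∀ t, i ≤ t → t + p ≤ j → u[t]? = u[t + p]?) (hlen : 2 * p ≤ j - i + 1) :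
    per (factor u i j) ∣ p := by
  have hw := (hasPeriod_factor_iff hj).mpr H
  obtain ⟨hq, hqw⟩ := per_factor_pos_and_hasPeriod hle hj
  have hqp := per_le hp hw
  have hg := List.HasPeriod.gcd hqw hw (by rw [length_factor hj]; omega)
  have := per_le (Nat.gcd_pos_of_pos_left p hq) hg
  have h2 := Nat.gcd_le_left p hq
  rw [show per (factor u i j) = (per (factor u i j)).gcd p by omega]
  exact Nat.gcd_dvd_right _ _

theorem IsHPRun.isMaxPer {u : List A} {i j : ℕ} (H : IsHPRun u i j) :
    IsMaxPer u (per (factor u i j)) i j :=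
  have hp := per_factor_pos_and_hasPeriod H.1.le H.1.lt_length
  ⟨hp.1, H.1.le, H.1.lt_length, by have := H.2; omega,
    (hasPeriod_factor_iff H.1.lt_length).mp hp.2, H.1.left_maximal, H.1.right_maximal⟩

/-- A maximal interval of period `p` and of length at least `3 * p` is an hp-run, even if `p` is
not its shortest period: an extension with the shortest period, a divisor of `p`, would be an
extension with the period `p`. -/
theorem IsMaxPer.isHPRun {u : List A} {p i j : ℕ} (H : IsMaxPer u p i j)
    (hlen : 3 * p ≤ j - i + 1) : IsHPRun u i j := by
  obtain ⟨hp, hle, hj, -, hper, hl, hr⟩ := H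
  obtain ⟨hq, hqw⟩ := per_factor_pos_and_hasPeriod hle hj
  have hdvd := per_dvd hp hle hj hper (by omega)
  have hqp := Nat.le_of_dvd hp hdvd
  rw [hasPeriod_factor_iff hj] at hqw
  generalize hQ : per (factor u i j) = q at *
  have hmod : q ≡ p [MOD q] := by
    rw [Nat.ModEq, Nat.mod_self, Nat.mod_eq_zero_of_dvd hdvd]
  refine ⟨⟨hle, hj, by omega, fun hi heq => hl hi ?_, fun hj1 heq => hr hj1 ?_⟩, by omega⟩
  · rw [heq, hQ]
    exact eq_of_modEq_of_periodic hqw (by omega) (by omega) (by omega) (by omega)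
      (Nat.ModEq.add_left _ hmod)
  · rw [← heq, hQ]
    refine eq_of_modEq_of_periodic hqw (by omega) (by omega) (by omega) (by omega) ?_
    refine Nat.ModEq.add_right_cancel hmod.symm ?_
    rw [Nat.sub_add_cancel (by omega)]
    rw [Nat.sub_add_cancel (by omega)]

theorem isHPRun_iff {u : List A} {i j : ℕ} :
    IsHPRun u i j ↔ ∃ p, IsMaxPer u p i j ∧ 3 * p ≤ j - i + 1 :=
  ⟨fun H => ⟨_, H.isMaxPer, H.2⟩, fun ⟨_, H, hlen⟩ => H.isHPRun hlen⟩

/-- Appending letters on the right of a word keeps the maximal periodic intervals that do not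
reach its end. -/
theorem isMaxPer_append_right_iff {u v : List A} {p i j : ℕ} (hj : j + 1 < u.length) :
    IsMaxPer (u ++ v) p i j ↔ IsMaxPer u p i j := by
  have key : ∀ t, t ≤ j + 1 → (u ++ v)[t]? = u[t]? := fun t ht =>
    List.getElem?_append_left (by omega)
  constructor
  · rintro ⟨hp, hle, -, hpl, hper, hl, hr⟩
    refine ⟨hp, hle, by omega, hpl, fun t h1 h2 => ?_, fun hi => ?_, fun _ => ?_⟩
    · rw [← key t (by omega), ← key (t + p) (by omega)]; exact hper t h1 h2
    · rw [← key _ (by omega), ← key (i - 1 + p) (by omega)]; exact hl hi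
    · rw [← key _ (by omega), ← key (j + 1) (by omega)]; exact hr (by simp; omega)
  · rintro ⟨hp, hle, -, hpl, hper, hl, hr⟩
    refine ⟨hp, hle, by simp; omega, hpl, fun t h1 h2 => ?_, fun hi => ?_, fun _ => ?_⟩
    · rw [key t (by omega), key (t + p) (by omega)]; exact hper t h1 h2
    · rw [key _ (by omega), key (i - 1 + p) (by omega)]; exact hl hi
    · rw [key _ (by omega), key (j + 1) (by omega)]; exact hr (by omega)

/-- Appending letters on the left of a word shifts the maximal periodic intervals that do not
start at its beginning. -/
theorem isMaxPer_append_left_iff {u v : List A} {p i j : ℕ} (hi : 0 < i) :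
    IsMaxPer (u ++ v) p (u.length + i) (u.length + j) ↔ IsMaxPer v p i j := by
  have key : ∀ t, (u ++ v)[u.length + t]? = v[t]? := fun t => by
    rw [List.getElem?_append_right (by omega), Nat.add_sub_cancel_left]
  constructor
  · rintro ⟨hp, hle, hj, hpl, hper, hl, hr⟩
    rw [List.length_append] at hj hr
    refine ⟨hp, by omega, by omega, by omega, fun t h1 h2 => ?_, fun _ => ?_, fun _ => ?_⟩
    · rw [← key t, ← key (t + p), ← add_assoc]; exact hper _ (by omega) (by omega)
    · rw [← key, ← key (i - 1 + p)]
      rw [← add_assoc, ← Nat.add_sub_assoc (by omega)]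
      exact hl (by omega)
    · rw [← key, ← key (j + 1)]
      rw [← add_assoc, ← Nat.add_sub_assoc (by omega), ← add_assoc]
      exact hr (by omega)
  · rintro ⟨hp, hle, hj, hpl, hper, hl, hr⟩
    refine ⟨hp, by omega, by simp; omega, by omega, fun t h1 h2 => ?_, fun _ => ?_, fun ht => ?_⟩
    · obtain ⟨s, rfl⟩ := Nat.exists_eq_add_of_le (show u.length ≤ t by omega)
      rw [add_assoc, key, key]; exact hper _ (by omega) (by omega)
    · rw [show u.length + i - 1 = u.length + (i - 1) by omega, add_assoc, key, key]
      exact hl hi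
    · rw [show u.length + j + 1 - p = u.length + (j + 1 - p) by omega, add_assoc, key, key]
      rw [List.length_append] at ht
      exact hr (by omega)

/-- A maximal periodic interval of a factor `v` is one of the whole word, provided that it reaches
an end of `v` only where `v` and the whole word end together. -/
theorem IsMaxPer.append_append {u v w : List A} {p i j : ℕ} (H : IsMaxPer v p i j)
    (hi : 0 < i ∨ u = []) (hj : j + 1 < v.length ∨ w = []) :
    IsMaxPer (u ++ (v ++ w)) p (u.length + i) (u.length + j) := by
  have H' : IsMaxPer (v ++ w) p i j := by
    rcases hj with hj | rfl
    · exact (isMaxPer_append_right_iff hj).mpr H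
    · simpa using H
  rcases hi with hi | rfl
  · exact (isMaxPer_append_left_iff hi).mpr H'
  · simpa using H'

theorem isHPRun_append_right_iff {u v : List A} {i j : ℕ} (hj : j + 1 < u.length) :
    IsHPRun (u ++ v) i j ↔ IsHPRun u i j := by
  simp only [isHPRun_iff, isMaxPer_append_right_iff hj]

theorem isHPRun_append_left_iff {u v : List A} {i j : ℕ} (hi : 0 < i) :
    IsHPRun (u ++ v) (u.length + i) (u.length + j) ↔ IsHPRun v i j := by
  simp only [isHPRun_iff, isMaxPer_append_left_iff hi]
  simp only [Nat.add_sub_add_left]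

/-! ### The hp-runs that touch a given position -/

/-- Two runs with the periods `p` and `q` that overlap in at least `p + q` letters are equal. -/
theorem eq_of_overlap {u : List A} {i j i' j' x y : ℕ} (H : IsHPRun u i j) (H' : IsHPRun u i' j')
    (hx : i ≤ x) (hx' : i' ≤ x) (hy : y ≤ j) (hy' : y ≤ j')
    (hlen : x + per (factor u i j) + per (factor u i' j') ≤ y + 1) : i = i' ∧ j = j' := by
  -- If the period `p` of an interval is shortest and a window of length at least `p` has a period
  -- `g` dividing `p`, then `g = p`.
  have key : ∀ {i j g : ℕ}, IsHPRun u i j → i ≤ x → y ≤ j → 0 < g → g ∣ per (factor u i j) →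
      x + per (factor u i j) ≤ y + 1 → (∀ t, x ≤ t → t + g ≤ y → u[t]? = u[t + g]?) →
      per (factor u i j) ≤ g := by
    intro i j g H hx hy hg hdvd hl hper
    have M := H.isMaxPer
    obtain ⟨hp, hle, hj, hpl, hpp, -, -⟩ := M
    generalize hQ : per (factor u i j) = p at *
    rw [← hQ]
    refine per_le hg ((hasPeriod_factor_iff hj).mpr fun t h1 h2 => ?_)
    -- the representative in the window of the class of `t` modulo `p`
    have rep : ∀ t, ∃ s, x ≤ s ∧ s < x + p ∧ s ≡ t [MOD p] := by
      intro t
      refine ⟨x + (t + p * x - x) % p, by omega,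
        by have := Nat.mod_lt (t + p * x - x) hp; omega, ?_⟩
      have : x ≤ p * x := Nat.le_mul_of_pos_left x hp
      calc x + (t + p * x - x) % p ≡ x + (t + p * x - x) [MOD p] :=
            Nat.ModEq.add_left _ (Nat.mod_modEq _ _)
        _ = t + p * x := by omega
        _ ≡ t [MOD p] := by rw [Nat.ModEq, Nat.add_mul_mod_self_left]
    obtain ⟨a, ha1, ha2, ha⟩ := rep t
    obtain ⟨b, hb1, hb2, hb⟩ := rep (t + g)
    rw [← eq_of_modEq_of_periodic hpp (by omega) (by omega) h1 (by omega) ha,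
      ← eq_of_modEq_of_periodic hpp (by omega) (by omega) (by omega) (by omega) hb]
    refine eq_of_modEq_of_periodic hper (by omega) (by omega) (by omega) (by omega) ?_
    have h3 := ha.of_dvd hdvd
    have h4 := hb.of_dvd hdvd
    refine h3.trans (Nat.ModEq.trans ?_ h4.symm)
    rw [Nat.ModEq, Nat.add_mod_right]
  have M := H.isMaxPer
  have M' := H'.isMaxPer
  have hyl : y < u.length := lt_of_le_of_lt hy M.lt_length
  have hp := M.pos
  have hq := M'.pos
  have hw : (factor u x y).HasPeriod (per (factor u i j)) :=
    (hasPeriod_factor_iff hyl).mpr fun t h1 h2 => M.periodic t (by omega) (by omega)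
  have hw' : (factor u x y).HasPeriod (per (factor u i' j')) :=
    (hasPeriod_factor_iff hyl).mpr fun t h1 h2 => M'.periodic t (by omega) (by omega)
  have hg := (hasPeriod_factor_iff hyl).mp
    (hw.gcd hw' (by rw [length_factor hyl]; omega))
  have e1 := key H hx hy (Nat.gcd_pos_of_pos_left _ hp) (Nat.gcd_dvd_left _ _) (by omega) hg
  have e2 := key H' hx' hy' (Nat.gcd_pos_of_pos_left _ hp) (Nat.gcd_dvd_right _ _) (by omega) hg
  have e3 := Nat.gcd_le_left (per (factor u i' j')) hp
  have e4 := Nat.gcd_le_right (per (factor u i j)) hq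
  have e : per (factor u i j) = per (factor u i' j') := by omega
  rw [← e] at M' hlen
  clear hg e1 e2 e3 e4 hw hw' e key
  generalize per (factor u i j) = p at *
  constructor
  · rcases lt_trichotomy i i' with hlt | heq | hlt
    · exact absurd (M.periodic (i' - 1) (by omega) (by omega)) (M'.left_maximal (by omega))
    · exact heq
    · exact absurd (M'.periodic (i - 1) (by omega) (by omega)) (M.left_maximal (by omega))
  · have a1 := M.lt_length
    have a2 := M'.lt_length
    rcases lt_trichotomy j j' with hlt | heq | hlt
    · refine absurd (M'.periodic (j + 1 - p) (by omega) (by omega)) ?_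
      rw [Nat.sub_add_cancel (by omega)]
      exact M.right_maximal (by omega)
    · exact heq
    · refine absurd (M.periodic (j' + 1 - p) (by omega) (by omega)) ?_
      rw [Nat.sub_add_cancel (by omega)]
      exact M'.right_maximal (by omega)

/-- The class of a run `[i..j]` of period `p` that touches the position `k`: the binary order of
magnitude `2 ^ t` of `p`, whether `p` is below `3/2 * 2 ^ t`, and the number of letters left of
`k`, in units of `2 ^ t / 2` and cut off at `4 * 2 ^ t`. -/
noncomputable def touchClass (u : List A) (k : ℕ) (q : ℕ × ℕ) : ℕ × Bool × ℕ :=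
  let p := per (factor u q.1 q.2)
  let t := Nat.log 2 p
  (t, decide (2 * p < 3 * 2 ^ t), min (2 * (k - q.1) / 2 ^ t) 8)

/-- Runs of the same class have periods `p ≤ q` with `2 * p - q` at least the unit in which the
letters left of `k` are counted, so they overlap in at least `p + q` letters. -/
theorem touchClass_injOn (u : List A) (k : ℕ) :
    Set.InjOn (touchClass u k) {q | IsHPRun u q.1 q.2 ∧ q.1 ≤ k ∧ k ≤ q.2 + 1} := by
  rintro ⟨i, j⟩ ⟨H, hik, hkj⟩ ⟨i', j'⟩ ⟨H', hik', hkj'⟩ heq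
  simp only at H H' hik hkj hik' hkj'
  simp only [touchClass, Prod.mk.injEq] at heq
  obtain ⟨h1, h2, h3⟩ := heq
  have hp := H.isMaxPer.pos
  have hq := H'.isMaxPer.pos
  have hlen := H.2
  have hlen' := H'.2
  have hle := H.1.le
  have hle' := H'.1.le
  have hov := fun x y => eq_of_overlap (x := x) (y := y) H H'
  generalize per (factor u i j) = p at *
  generalize per (factor u i' j') = q at *
  rw [← h1] at h2 h3
  have l1 := Nat.pow_log_le_self 2 hp.ne'
  have l2 := Nat.lt_pow_succ_log_self Nat.one_lt_two p
  have l3 := Nat.pow_log_le_self 2 hq.ne'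
  have l4 := Nat.lt_pow_succ_log_self Nat.one_lt_two q
  rw [← h1] at l3 l4
  rw [Nat.pow_succ] at l2 l4
  generalize 2 ^ Nat.log 2 p = T at *
  have hT : 0 < T := by omega
  rw [decide_eq_decide] at h2
  have d1 := Nat.div_add_mod (2 * (k - i)) T
  have d2 := Nat.div_add_mod (2 * (k - i')) T
  have d3 := Nat.mod_lt (2 * (k - i)) hT
  have d4 := Nat.mod_lt (2 * (k - i')) hT
  generalize 2 * (k - i) / T = a at *
  generalize 2 * (k - i') / T = b at *
  have hfin : (max i i') + p + q ≤ min j j' + 1 := by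
    by_cases ha : 8 ≤ a
    · have hb : 8 ≤ b := by omega
      have m1 := Nat.mul_le_mul_left T ha
      have m2 := Nat.mul_le_mul_left T hb
      omega
    · have hab : a = b := by omega
      subst hab
      by_cases hc : 2 * p < 3 * T
      · have := h2.mp hc
        omega
      · have : ¬ 2 * q < 3 * T := fun hh => hc (h2.mpr hh)
        omega
  have := hov (max i i') (min j j') (by omega) (by omega) (by omega) (by omega) hfin
  rw [this.1, this.2]

/-- Only logarithmically many hp-runs touch a given position. -/
theorem ncard_touching_le (u : List A) (k : ℕ) :
    {q : ℕ × ℕ | IsHPRun u q.1 q.2 ∧ q.1 ≤ k ∧ k ≤ q.2 + 1}.ncard ≤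
      18 * (Nat.log 2 u.length + 1) := by
  have hmaps : ∀ q ∈ {q : ℕ × ℕ | IsHPRun u q.1 q.2 ∧ q.1 ≤ k ∧ k ≤ q.2 + 1},
      touchClass u k q ∈ ((Finset.range (Nat.log 2 u.length + 1) ×ˢ
        (Finset.univ : Finset Bool) ×ˢ Finset.range 9 : Finset (ℕ × Bool × ℕ)) :
          Set (ℕ × Bool × ℕ)) := by
    rintro ⟨i, j⟩ ⟨H, -, -⟩
    have h1 := H.2
    have h2 := H.1.lt_length
    simp only at h1 h2
    have := Nat.log_mono_right (b := 2) (show per (factor u i j) ≤ u.length by omega)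
    simp only [touchClass, Finset.coe_product, Set.mem_prod, Finset.mem_coe, Finset.mem_range,
      Finset.mem_univ, true_and]
    omega
  refine (Set.ncard_le_ncard_of_injOn _ hmaps (touchClass_injOn u k) (Finset.finite_toSet _)).trans
    ?_
  rw [Set.ncard_coe_finset]
  simp
  omega

end Runs
/-! ### The limit of the densities exists -/

section Runs

variable {A : Type*}

/-- Concatenation changes the number of hp-runs only by the hp-runs at the junction. -/
theorem abs_hpRuns_append_sub_le (u v : List A) :
    |(hpRuns (u ++ v) : ℝ) - hpRuns u - hpRuns v| ≤ 36 * (Nat.log 2 (u ++ v).length + 1) := by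
  set n := u.length
  set S := {q : ℕ × ℕ | IsHPRun (u ++ v) q.1 q.2}
  set T := {q : ℕ × ℕ | IsHPRun (u ++ v) q.1 q.2 ∧ q.1 ≤ n ∧ n ≤ q.2 + 1}
  set U := {q : ℕ × ℕ | IsHPRun u q.1 q.2}
  set UT := {q : ℕ × ℕ | IsHPRun u q.1 q.2 ∧ q.1 ≤ n ∧ n ≤ q.2 + 1}
  set V := {q : ℕ × ℕ | IsHPRun v q.1 q.2}
  set VT := {q : ℕ × ℕ | IsHPRun v q.1 q.2 ∧ q.1 ≤ 0 ∧ 0 ≤ q.2 + 1}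
  -- the hp-runs that end before the junction, and those that begin after it
  set L := {q : ℕ × ℕ | IsHPRun u q.1 q.2 ∧ q.2 + 1 < n}
  set R := {q : ℕ × ℕ | IsHPRun v q.1 q.2 ∧ 0 < q.1}
  set R' := {q : ℕ × ℕ | IsHPRun (u ++ v) q.1 q.2 ∧ n < q.1}
  have fS : S.Finite := finite_setOf_isHPRun _
  have fU : U.Finite := finite_setOf_isHPRun _
  have fV : V.Finite := finite_setOf_isHPRun _
  have hU : U = L ∪ UT := by
    ext q
    simp only [U, L, UT, Set.mem_ofPred_eq, Set.mem_union]
    constructor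
    · intro H
      have := H.1.le; have := H.1.lt_length
      by_cases h : q.2 + 1 < n
      · exact Or.inl ⟨H, h⟩
      · exact Or.inr ⟨H, by omega, by omega⟩
    · rintro (H | H) <;> exact H.1
  have hV : V = R ∪ VT := by
    ext q
    simp only [V, R, VT, Set.mem_ofPred_eq, Set.mem_union]
    constructor
    · intro H
      by_cases h : 0 < q.1
      · exact Or.inl ⟨H, h⟩
      · exact Or.inr ⟨H, by omega, by omega⟩
    · rintro (H | H) <;> exact H.1
  have hS : S = L ∪ R' ∪ T := by
    ext q
    simp only [S, L, R', T, Set.mem_ofPred_eq, Set.mem_union]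
    constructor
    · intro H
      by_cases h : q.2 + 1 < n
      · exact Or.inl (Or.inl ⟨(isHPRun_append_right_iff h).mp H, h⟩)
      · by_cases h2 : n < q.1
        · exact Or.inl (Or.inr ⟨H, h2⟩)
        · exact Or.inr ⟨H, by omega, by omega⟩
    · rintro ((H | H) | H)
      · exact (isHPRun_append_right_iff H.2).mpr H.1
      · exact H.1
      · exact H.1
  have hR : R'.ncard = R.ncard := by
    have : R' = (fun q : ℕ × ℕ => (n + q.1, n + q.2)) '' R := by
      ext ⟨i, j⟩
      simp only [R, R', Set.mem_ofPred_eq, Set.mem_image, Prod.mk.injEq, Prod.exists]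
      constructor
      · rintro ⟨H, h⟩
        have := H.1.le
        obtain ⟨a, rfl⟩ := Nat.exists_eq_add_of_le h.le
        obtain ⟨b, rfl⟩ := Nat.exists_eq_add_of_le (show n ≤ j by omega)
        exact ⟨a, b, ⟨(isHPRun_append_left_iff (by omega)).mp H, by omega⟩, rfl, rfl⟩
      · rintro ⟨a, b, ⟨H, h⟩, rfl, rfl⟩
        exact ⟨(isHPRun_append_left_iff h).mpr H, by omega⟩
    rw [this]
    refine Set.ncard_image_of_injective _ fun a b hab => ?_
    simp only [Prod.mk.injEq, Nat.add_left_cancel_iff] at hab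
    exact Prod.ext hab.1 hab.2
  have hLR : (L ∪ R').ncard = L.ncard + R'.ncard := by
    refine Set.ncard_union_eq ?_ (fU.subset (hU ▸ Set.subset_union_left))
      (fS.subset fun q hq => hq.1)
    refine Set.disjoint_left.mpr fun q h1 h2 => ?_
    have := h1.1.1.le; have := h1.2; have := h2.2
    omega
  have log_le : ∀ m ≤ (u ++ v).length,
      18 * (Nat.log 2 m + 1) ≤ 18 * (Nat.log 2 (u ++ v).length + 1) := fun m hm => by
    have := Nat.log_mono_right (b := 2) hm
    omega
  have bT : T.ncard ≤ 18 * (Nat.log 2 (u ++ v).length + 1) := ncard_touching_le _ _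
  have bUT : UT.ncard ≤ 18 * (Nat.log 2 (u ++ v).length + 1) :=
    (ncard_touching_le u n).trans (log_le _ (by simp))
  have bVT : VT.ncard ≤ 18 * (Nat.log 2 (u ++ v).length + 1) :=
    (ncard_touching_le v 0).trans (log_le _ (by simp))
  have s1 : S.ncard ≤ L.ncard + R.ncard + T.ncard := by
    rw [hS, ← hR, ← hLR]; exact Set.ncard_union_le _ _
  have s2 : L.ncard + R.ncard ≤ S.ncard := by
    rw [← hR, ← hLR]; exact Set.ncard_le_ncard (hS ▸ Set.subset_union_left) fS
  have u1 : U.ncard ≤ L.ncard + UT.ncard := by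
    conv_lhs => rw [hU]
    exact Set.ncard_union_le _ _
  have u2 : L.ncard ≤ U.ncard := Set.ncard_le_ncard (fun q hq => hq.1) fU
  have v1 : V.ncard ≤ R.ncard + VT.ncard := by
    conv_lhs => rw [hV]
    exact Set.ncard_union_le _ _
  have v2 : R.ncard ≤ V.ncard := Set.ncard_le_ncard (fun q hq => hq.1) fV
  change |(S.ncard : ℝ) - U.ncard - V.ncard| ≤ _
  generalize Nat.log 2 (u ++ v).length = m at *
  rw [abs_le]
  constructor
  · have : U.ncard + V.ncard ≤ S.ncard + 36 * (m + 1) := by omega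
    have : (U.ncard + V.ncard : ℝ) ≤ S.ncard + 36 * (m + 1) := by exact_mod_cast this
    linarith
  · have : S.ncard ≤ U.ncard + V.ncard + 36 * (m + 1) := by omega
    have : (S.ncard : ℝ) ≤ U.ncard + V.ncard + 36 * (m + 1) := by exact_mod_cast this
    linarith

end Runs

/-- The word over `{a, b}` for which `h ^ k w` stands. -/
def E (k : ℕ) (w : List Greek) : List Letter := (h^[k] w).flatMap expand

theorem h_append (v w : List Greek) : h (v ++ w) = h v ++ h w := List.flatMap_append

theorem iterate_h_append (k : ℕ) (v w : List Greek) : h^[k] (v ++ w) = h^[k] v ++ h^[k] w := by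
  induction k generalizing v w with
  | zero => rfl
  | succ k ih => simp only [Function.iterate_succ_apply, h_append, ih]

theorem E_append (k : ℕ) (v w : List Greek) : E k (v ++ w) = E k v ++ E k w := by
  simp [E, iterate_h_append]

theorem E_succ (k : ℕ) (w : List Greek) : E (k + 1) w = E k (h w) := by
  simp [E]

theorem E_succ_α (k : ℕ) : E (k + 1) [Greek.α] = E k [Greek.α] ++ E k [Greek.β] := by
  rw [E_succ, ← E_append]; rfl

theorem E_succ_β (k : ℕ) : E (k + 1) [Greek.β] = E k [Greek.α] := by
  rw [E_succ]; rfl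

theorem f_eq_E (k m : ℕ) : f (k + m) = E k (h^[m] [Greek.α]) := by
  simp [f, E, Function.iterate_add_apply]

theorem f_add_two (n : ℕ) : f (n + 2) = f (n + 1) ++ f n := by
  have : ∀ n, f n = E n [Greek.α] := fun n => rfl
  rw [this, this, this, E_succ_α, E_succ_β]

theorem ℓ_zero : ℓ 0 = 26 := by decide

theorem ℓ_one : ℓ 1 = 45 := by decide

theorem ℓ_add_two (n : ℕ) : ℓ (n + 2) = ℓ (n + 1) + ℓ n := by
  simp [ℓ, f_add_two]

theorem ℓ_le_succ (n : ℕ) : ℓ n ≤ ℓ (n + 1) := by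
  cases n with
  | zero => simp [ℓ_zero, ℓ_one]
  | succ n => rw [ℓ_add_two]; omega

theorem ℓ_pos (n : ℕ) : 26 ≤ ℓ n := by
  induction n with
  | zero => exact ℓ_zero.ge
  | succ n ih => exact ih.trans (ℓ_le_succ n)

theorem ℓ_succ_le_two_mul (n : ℕ) : ℓ (n + 1) ≤ 2 * ℓ n := by
  cases n with
  | zero => simp [ℓ_zero, ℓ_one]
  | succ n => rw [ℓ_add_two]; have := ℓ_le_succ n; omega

theorem ℓ_le_two_pow (n : ℕ) : ℓ n ≤ 2 ^ (n + 5) := by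
  induction n with
  | zero => simp [ℓ_zero]
  | succ n ih =>
    have := ℓ_succ_le_two_mul n
    rw [show n + 1 + 5 = n + 5 + 1 by ring, pow_succ]
    omega

theorem pow_le_ℓ (n : ℕ) : (3 / 2 : ℝ) ^ n ≤ ℓ n := by
  induction n with
  | zero => simp [ℓ_zero]
  | succ n ih =>
    cases n with
    | zero => norm_num [ℓ_one]
    | succ n =>
      have h2 : (ℓ (n + 1 + 1) : ℝ) = ℓ (n + 1) + ℓ n := by exact_mod_cast ℓ_add_two n
      have h3 : (ℓ (n + 1) : ℝ) ≤ 2 * ℓ n := by exact_mod_cast ℓ_succ_le_two_mul n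
      rw [pow_succ, h2]
      linarith

/-- The excess of `r (n + 2)` over `r (n + 1) + r n` is linear in `n`, and so exponentially small
against `ℓ (n + 2)`. -/
theorem abs_r_sub_div_le (n : ℕ) :
    |(r (n + 2) : ℝ) - r (n + 1) - r n| / ℓ (n + 2) ≤ 324 * (4 / 5 : ℝ) ^ n := by
  have h1 := abs_hpRuns_append_sub_le (f (n + 1)) (f n)
  rw [← f_add_two] at h1
  have h2 : Nat.log 2 (f (n + 2)).length ≤ n + 7 := by
    calc Nat.log 2 (f (n + 2)).length ≤ Nat.log 2 (2 ^ (n + 7)) :=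
          Nat.log_mono_right (ℓ_le_two_pow (n + 2))
      _ = n + 7 := Nat.log_pow Nat.one_lt_two _
  have h2' : (Nat.log 2 (f (n + 2)).length : ℝ) ≤ n + 7 := by exact_mod_cast h2
  have h3 := pow_le_ℓ (n + 2)
  have h4 := one_add_mul_le_pow (a := (1 / 5 : ℝ)) (by norm_num) n
  have h5 : (4 / 5 : ℝ) ^ n * (3 / 2) ^ n = (1 + 1 / 5) ^ n := by
    rw [← mul_pow]; norm_num
  have h6 : (3 / 2 : ℝ) ^ n ≤ ℓ (n + 2) := by
    refine le_trans ?_ h3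
    exact pow_le_pow_right₀ (by norm_num) (by omega)
  have hpos : (0 : ℝ) < ℓ (n + 2) := lt_of_lt_of_le (by positivity) h3
  rw [div_le_iff₀ hpos]
  calc |(r (n + 2) : ℝ) - r (n + 1) - r n| ≤ 36 * (n + 8) := by
        refine h1.trans ?_; linarith
    _ ≤ 324 * (1 + 1 / 5) ^ n := by
        have : (0 : ℝ) ≤ n := Nat.cast_nonneg n
        linarith
    _ = 324 * (4 / 5 : ℝ) ^ n * (3 / 2) ^ n := by rw [← h5]; ring
    _ ≤ 324 * (4 / 5 : ℝ) ^ n * ℓ (n + 2) := by gcongr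

/-- Each density is, up to an exponentially small error, the weighted mean of the two before it,
so the increments decrease exponentially. -/
theorem exists_tendsto_density :
    ∃ L : ℝ, Tendsto (fun n : ℕ => (r n : ℝ) / (ℓ n : ℝ)) atTop (𝓝 L) := by
  set x : ℕ → ℝ := fun n => (r n : ℝ) / (ℓ n : ℝ) with hx
  -- the error `324 * (4 / 5) ^ n` fits into `(4 / 5 - 1 / 2) * K * (4 / 5) ^ n` if `K ≥ 1080`
  set K : ℝ := |x 1 - x 0| + 1080 with hK
  have step : ∀ n, |x (n + 2) - x (n + 1)| ≤ 1 / 2 * |x (n + 1) - x n| + 324 * (4 / 5) ^ n := by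
    intro n
    have p0 : (0 : ℝ) < ℓ n := by have := ℓ_pos n; positivity
    have p1 : (0 : ℝ) < ℓ (n + 1) := by have := ℓ_pos (n + 1); positivity
    have p2 : (ℓ (n + 2) : ℝ) = ℓ (n + 1) + ℓ n := by exact_mod_cast ℓ_add_two n
    have p3 : (ℓ n : ℝ) ≤ ℓ (n + 1) := by exact_mod_cast ℓ_le_succ n
    have p4 : (0 : ℝ) < ℓ (n + 2) := by linarith
    have e : x (n + 2) - x (n + 1) = -((ℓ n / ℓ (n + 2)) * (x (n + 1) - x n)) +
        ((r (n + 2) : ℝ) - r (n + 1) - r n) / ℓ (n + 2) := by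
      simp only [hx]
      rw [p2]
      field_simp
      ring
    have hw : (ℓ n / ℓ (n + 2) : ℝ) ≤ 1 / 2 := by
      rw [div_le_iff₀ p4]; linarith
    have he := abs_r_sub_div_le n
    rw [e]
    refine (abs_add_le _ _).trans (add_le_add ?_ ?_)
    · rw [abs_neg, abs_mul, abs_of_pos (div_pos p0 p4)]
      exact mul_le_mul_of_nonneg_right hw (abs_nonneg _)
    · rwa [abs_div, abs_of_pos p4]
  have geo : ∀ n, |x (n + 1) - x n| ≤ K * (4 / 5) ^ n := by
    intro n
    induction n with
    | zero => simp only [zero_add, pow_zero, mul_one, hK]; linarith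
    | succ n ih =>
      have hp : (0 : ℝ) < (4 / 5) ^ n := by positivity
      have hK' : (1080 : ℝ) ≤ K := by simp [hK]
      have := step n
      rw [pow_succ]
      nlinarith
  have hc : CauchySeq x := cauchySeq_of_le_geometric (4 / 5) K (by norm_num) fun n => by
    rw [dist_comm, Real.dist_eq]; exact geo n
  exact cauchySeq_tendsto_of_complete hc

/-! ### Fibonacci words over the Greek alphabet -/

theorem iterate_h_add_two (n : ℕ) :
    h^[n + 2] [Greek.α] = h^[n + 1] [Greek.α] ++ h^[n] [Greek.α] := by
  have h1 : h^[n + 2] [Greek.α] = h^[n + 1] ([Greek.α] ++ [Greek.β]) := rfl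
  have h2 : h^[n + 1] [Greek.β] = h^[n] [Greek.α] := rfl
  rw [h1, iterate_h_append, h2]

/-- The last two letters of a Fibonacci word are distinct. -/
theorem iterate_h_succ_suffix (n : ℕ) :
    [Greek.α, Greek.β] <:+ h^[n + 1] [Greek.α] ∨ [Greek.β, Greek.α] <:+ h^[n + 1] [Greek.α] := by
  induction n using Nat.twoStepInduction with
  | zero => exact Or.inl ⟨[], rfl⟩
  | one => exact Or.inr ⟨[Greek.α], rfl⟩
  | more n ih _ =>
    rw [show n + 2 + 1 = (n + 1) + 2 by ring, iterate_h_add_two]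
    exact ih.imp (·.trans (List.suffix_append _ _)) (·.trans (List.suffix_append _ _))

theorem iterate_h_odd_suffix (n : ℕ) :
    [Greek.β, Greek.α, Greek.α, Greek.β] <:+ h^[2 * n + 3] [Greek.α] := by
  induction n with
  | zero => exact ⟨[Greek.α], rfl⟩
  | succ n ih =>
    rw [show 2 * (n + 1) + 3 = (2 * n + 3) + 2 by ring, iterate_h_add_two]
    exact ih.trans (List.suffix_append _ _)

/-- The sum of the weights of the letters of a word, where the weight of a letter may depend on the
part of the word after it. -/
def weightSum (wt : Greek → List Greek → ℕ) : List Greek → ℕ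
  | [] => 0
  | x :: V => wt x V + weightSum wt V

/-- If the elements of `S` can be charged to the letters of `G`, an element `q` being charged to the
letter in whose block of the word `G.flatMap σ` the position `q.1 + c` lies, then `S` has at least
as many elements as the sum of the weights of the letters. -/
theorem exists_finset_weightSum_le (σ : Greek → List Letter) (S : Set (ℕ × ℕ)) (c : ℕ)
    (wt : Greek → List Greek → ℕ) (G : List Greek)
    (H : ∀ U x V, G = U ++ x :: V → ∃ T : Finset (ℕ × ℕ), wt x V ≤ T.card ∧ ↑T ⊆ S ∧
      ∀ q ∈ T, (U.flatMap σ).length ≤ q.1 + c ∧ q.1 + c < ((U ++ [x]).flatMap σ).length) :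
    ∃ T : Finset (ℕ × ℕ), weightSum wt G ≤ T.card ∧ ↑T ⊆ S := by
  suffices key : ∀ V U, G = U ++ V → ∃ T : Finset (ℕ × ℕ), weightSum wt V ≤ T.card ∧ ↑T ⊆ S ∧
      ∀ q ∈ T, (U.flatMap σ).length ≤ q.1 + c by
    obtain ⟨T, h1, h2, -⟩ := key G [] rfl
    exact ⟨T, h1, h2⟩
  intro V
  induction V with
  | nil => exact fun U _ => ⟨∅, by simp [weightSum], by simp, by simp⟩
  | cons x V ih =>
    intro U hU
    obtain ⟨T, h1, h2, h3⟩ := H U x V hU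
    obtain ⟨T', h1', h2', h3'⟩ := ih (U ++ [x]) (by simp [hU])
    have hd : Disjoint T T' := Finset.disjoint_left.mpr fun q hq hq' => by
      have := (h3 q hq).2; have := h3' q hq'; omega
    refine ⟨T ∪ T', ?_, ?_, fun q hq => ?_⟩
    · rw [Finset.card_union_of_disjoint hd, weightSum]; omega
    · rw [Finset.coe_union]; exact Set.union_subset h2 h2'
    · rcases Finset.mem_union.mp hq with hq | hq
      · exact (h3 q hq).1
      · have := h3' q hq
        rw [List.flatMap_append, List.length_append] at this
        omega

theorem weightSum_append_of_const (m : Greek → ℕ) (U V : List Greek) :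
    weightSum (fun x _ => m x) (U ++ V) =
      weightSum (fun x _ => m x) U + weightSum (fun x _ => m x) V := by
  induction U with
  | nil => simp [weightSum]
  | cons x U ih => simp [weightSum, ih, add_assoc]

theorem weightSum_iterate_h (m : Greek → ℕ) (n : ℕ) :
    weightSum (fun x _ => m x) (h^[n] [Greek.α]) =
      m Greek.α * Nat.fib (n + 1) + m Greek.β * Nat.fib n := by
  induction n using Nat.twoStepInduction with
  | zero => simp [weightSum]
  | one => simp [weightSum, h, fibLetter]
  | more n ih1 ih2 =>
    rw [iterate_h_add_two, weightSum_append_of_const, ih1, ih2, Nat.fib_add_two (n := n + 1),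
      Nat.fib_add_two (n := n)]
    ring

theorem ℓ_eq (n : ℕ) : ℓ n = 26 * Nat.fib (n + 1) + 19 * Nat.fib n := by
  induction n using Nat.twoStepInduction with
  | zero => simp [ℓ_zero]
  | one => simp [ℓ_one]
  | more n ih1 ih2 =>
    rw [ℓ_add_two, ih1, ih2, Nat.fib_add_two (n := n + 1), Nat.fib_add_two (n := n)]
    ring

/-! ### The hp-runs of the periods 1, 6 and 7 -/

instance : DecidableEq Letter
  | .a, .a => isTrue rfl
  | .a, .b => isFalse nofun
  | .b, .a => isFalse nofun
  | .b, .b => isTrue rfl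

theorem isMaxPer_iff {A : Type*} {u : List A} {p i j : ℕ} : IsMaxPer u p i j ↔
    0 < p ∧ i ≤ j ∧ j < u.length ∧ p ≤ j - i + 1 ∧
      (∀ t < u.length, i ≤ t → t + p ≤ j → u[t]? = u[t + p]?) ∧
      (0 < i → u[i - 1]? ≠ u[i - 1 + p]?) ∧ (j + 1 < u.length → u[j + 1 - p]? ≠ u[j + 1]?) :=
  ⟨fun ⟨h1, h2, h3, h4, h5, h6, h7⟩ => ⟨h1, h2, h3, h4, fun t _ => h5 t, h6, h7⟩,
    fun ⟨h1, h2, h3, h4, h5, h6, h7⟩ =>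
      ⟨h1, h2, h3, h4, fun t ht htp => h5 t (by omega) ht htp, h6, h7⟩⟩

instance {A : Type*} [DecidableEq A] (u : List A) (p i j : ℕ) : Decidable (IsMaxPer u p i j) :=
  decidable_of_iff' _ isMaxPer_iff

/-- The last four letters of every block, if there is a block on the left. -/
def leftContext : Bool → List Letter
  | true => [.b, .b, .b, .a]
  | false => []

/-- The common prefix of all blocks, if there is a block on the right. -/
def rightContext : Bool → List Letter
  | true => X
  | false => []

/-- The hp-runs charged to the block of a letter, as triples of a period and the two ends of the
run in the block with its contexts. The first one, a power of `a`, includes the last letter of the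
block on the left. The others are the powers of letters inside the block, the run of period 6 that
extends the prefix `X`, and the run of period 7 around the junction of `Y` with a block on the
right. -/
def localRuns (x : Greek) (l r : Bool) : List (ℕ × ℕ × ℕ) :=
  let c := (leftContext l).length
  [(1, c - 1, c + 2), (1, c + 3, c + 5), (1, c + 6, c + 8), (1, c + 9, c + 11), (1, c + 12, c + 14),
    (1, c + 15, c + 17)] ++
  match x, r with
  | .α, true => [(6, c, c + 20), (1, c + 18, c + 21), (1, c + 22, c + 24), (7, c + 12, c + 34)]
  | .α, false => [(6, c, c + 20), (1, c + 18, c + 21), (1, c + 22, c + 24)]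
  | .β, true => [(6, c, c + 20)]
  | .β, false => [(6, c, c + 18)]

/-- The number of hp-runs charged to the block of a letter. -/
def localWeight : Greek → List Greek → ℕ
  | .α, [] => 9
  | .α, _ :: _ => 10
  | .β, _ => 7

/-- The listed intervals are runs of the block with its contexts, they reach an end of that word
only where it is an end of the whole word, and each starts inside the block or one letter before it. -/
theorem localRuns_spec (x : Greek) (l r : Bool) : ∀ s ∈ localRuns x l r,
    IsMaxPer (leftContext l ++ expand x ++ rightContext r) s.1 s.2.1 s.2.2 ∧
    3 * s.1 ≤ s.2.2 - s.2.1 + 1 ∧ s.2.2 < s.2.1 + 25 ∧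
    (0 < s.2.1 ∨ l = false) ∧
    (s.2.2 + 1 < (leftContext l ++ expand x ++ rightContext r).length ∨ r = false) ∧
    (leftContext l).length ≤ s.2.1 + 1 ∧
    s.2.1 + 1 < (leftContext l).length + (expand x).length := by
  cases x <;> cases l <;> cases r <;> decide +kernel

theorem nodup_localRuns (x : Greek) (l r : Bool) :
    ((localRuns x l r).map Prod.snd).Nodup := by
  cases x <;> cases l <;> cases r <;> decide +kernel

theorem exists_left_context (U : List Greek) :
    ∃ (l : Bool) (P : List Letter), U.flatMap expand = P ++ leftContext l ∧
      (l = false → P = []) := by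
  rcases List.eq_nil_or_concat U with rfl | ⟨U, x, rfl⟩
  · exact ⟨false, [], rfl, fun _ => rfl⟩
  · have : ∃ B, expand x = B ++ leftContext true := by
      cases x
      · exact ⟨(expand .α).take 22, rfl⟩
      · exact ⟨(expand .β).take 15, rfl⟩
    obtain ⟨B, hB⟩ := this
    exact ⟨true, U.flatMap expand ++ B, by simp [hB], by simp⟩

theorem exists_right_context (V : List Greek) :
    ∃ (r : Bool) (S : List Letter), V.flatMap expand = rightContext r ++ S ∧
      (r = false → S = [] ∧ V = []) := by
  cases V with
  | nil => exact ⟨false, [], rfl, fun _ => ⟨rfl, rfl⟩⟩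
  | cons x V =>
    refine ⟨true, (expand x).drop 18 ++ V.flatMap expand, ?_, by simp⟩
    cases x <;> rfl

/-- The runs of the periods 1, 6 and 7 in any word composed of `α` and `β`. -/
theorem exists_finset_local (G : List Greek) : ∃ T : Finset (ℕ × ℕ),
    weightSum localWeight G ≤ T.card ∧
      ↑T ⊆ {q : ℕ × ℕ | IsHPRun (G.flatMap expand) q.1 q.2 ∧ q.2 < q.1 + 25} := by
  -- the first run of a block may start with the last letter of the block before, hence the shift 1
  refine exists_finset_weightSum_le expand _ 1 localWeight G fun U x V hG => ?_
  obtain ⟨l, P, hU, hP⟩ := exists_left_context U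
  obtain ⟨r, S, hV, hS⟩ := exists_right_context V
  have hinj : Function.Injective fun q : ℕ × ℕ => (P.length + q.1, P.length + q.2) := by
    intro a b hab
    simp only [Prod.mk.injEq, Nat.add_left_cancel_iff] at hab
    exact Prod.ext hab.1 hab.2
  refine ⟨(((localRuns x l r).map Prod.snd).toFinset).image
    fun q => (P.length + q.1, P.length + q.2), ?_, ?_, ?_⟩
  · rw [Finset.card_image_of_injective _ hinj, List.toFinset_card_of_nodup (nodup_localRuns x l r),
      List.length_map]
    cases x with
    | α =>
      cases r with
      | false => rw [(hS rfl).2]; simp [localRuns, localWeight]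
      | true => cases V <;> simp [localRuns, localWeight]
    | β => cases r <;> simp [localRuns, localWeight]
  · intro q hq
    simp only [Finset.coe_image, Set.mem_image, Finset.mem_coe, List.mem_toFinset,
      List.mem_map] at hq
    obtain ⟨-, ⟨s, hs, rfl⟩, rfl⟩ := hq
    obtain ⟨h1, h2, h3, h4, h5, -, -⟩ := localRuns_spec x l r s hs
    refine ⟨?_, by simp only; omega⟩
    rw [hG, List.flatMap_append, List.flatMap_cons, hU, hV,
      show P ++ leftContext l ++ (expand x ++ (rightContext r ++ S)) =
        P ++ ((leftContext l ++ expand x ++ rightContext r) ++ S) by simp]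
    exact (h1.append_append (h4.imp_right hP) (h5.imp_right fun h => (hS h).1)).isHPRun
      (by omega)
  · intro q hq
    simp only [Finset.mem_image, List.mem_toFinset, List.mem_map] at hq
    obtain ⟨-, ⟨s, hs, rfl⟩, rfl⟩ := hq
    obtain ⟨-, -, -, -, -, h6, h7⟩ := localRuns_spec x l r s hs
    simp only [List.flatMap_append, hU, List.length_append, List.flatMap_cons, List.flatMap_nil,
      List.length_nil]
    omega

/-- The weight of a letter inside a word. -/
def innerWeight : Greek → ℕ
  | .α => 10
  | .β => 7

theorem weightSum_innerWeight_le (G : List Greek) :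
    weightSum (fun x _ => innerWeight x) G ≤ weightSum localWeight G + 1 := by
  induction G with
  | nil => simp [weightSum]
  | cons x V ih =>
    rcases x with _ | _
    · cases V <;> simp only [weightSum, localWeight, innerWeight] at * <;> omega
    · simp only [weightSum, localWeight, innerWeight] at *; omega

/-- Only a final letter `α` is charged with one run less than an inner one. -/
theorem weightSum_innerWeight_concat_β (U : List Greek) :
    weightSum (fun x _ => innerWeight x) (U ++ [Greek.β]) =
      weightSum localWeight (U ++ [Greek.β]) := by
  induction U with
  | nil => rfl
  | cons x U ih =>
    have : ∃ y W, U ++ [Greek.β] = y :: W := by cases U <;> simp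
    obtain ⟨y, W, hW⟩ := this
    rw [hW] at ih
    cases x <;> simp only [List.cons_append, hW, weightSum, localWeight, innerWeight] at * <;> omega

/-! ### The hp-runs of long periods -/

/-- The words `h ^ k α` and `h ^ k β` over `{a, b}` have a common suffix of exactly 7 letters, and
`h ^ k (αβ)` and `h ^ k (βα)` have a common prefix of all but the last 17 letters. -/
theorem E_common (k : ℕ) : ∃ (A B C z s s' : List Letter) (c d c' d' : Letter),
    E k [Greek.α] = A ++ c :: z ∧ E k [Greek.β] = B ++ d :: z ∧ c ≠ d ∧ z.length = 7 ∧
    E k [Greek.α] ++ E k [Greek.β] = C ++ c' :: s ∧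
    E k [Greek.β] ++ E k [Greek.α] = C ++ d' :: s' ∧ c' ≠ d' ∧ C.length + 17 = ℓ (k + 1) := by
  induction k with
  | zero =>
    -- `α = X aaaabbba` and `β = aaabbbaaabb b aaabbba`, while `αβ` and `βα` agree in `X aaaabbbaaa`
    exact ⟨(expand .α).take 18, (expand .β).take 11, (expand .α ++ expand .β).take 28,
      (expand .α).drop 19, (expand .α ++ expand .β).drop 29, (expand .β ++ expand .α).drop 29,
      .a, .b, .a, .b, by decide, by decide, by decide, by decide, by decide, by decide, by decide,
      by decide⟩
  | succ k ih =>
    obtain ⟨A, B, C, z, s, s', c, d, c', d', h1, h2, h3, h4, h5, h6, h7, h8⟩ := ih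
    refine ⟨E k [Greek.α] ++ B, A, E k [Greek.α] ++ C, z, s', s, d, c, d', c', ?_, ?_, h3.symm, h4,
      ?_, ?_, h7.symm, ?_⟩
    · rw [E_succ_α, h2]; simp
    · rw [E_succ_β, h1]
    · rw [E_succ_α, E_succ_β, List.append_assoc, h6]; simp
    · rw [E_succ_α, E_succ_β, h5]; simp
    · rw [ℓ_add_two, List.length_append]
      have : (E k [Greek.α]).length = ℓ k := rfl
      omega

/-- The square `AA` in `BAABA` extends to the left by the common suffix `z` of `A` and `B`, and to
the right by the common prefix `C` of `AB` and `BA`. -/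
theorem isMaxPer_of_common {L : Type*} {A B A' B' C z s s' : List L} {c d c' d' : L}
    (h1 : A = A' ++ c :: z) (h2 : B = B' ++ d :: z) (h3 : c ≠ d)
    (h5 : A ++ B = C ++ c' :: s) (h6 : B ++ A = C ++ d' :: s') (h7 : c' ≠ d') :
    IsMaxPer (B ++ (A ++ (A ++ (B ++ A)))) A.length (B'.length + 1)
      (B.length + 2 * A.length + C.length - 1) := by
  have lA : A.length = A'.length + (z.length + 1) := by rw [h1]; simp
  have lB : B.length = B'.length + (z.length + 1) := by rw [h2]; simp
  have lC : A.length + B.length = C.length + (s.length + 1) := by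
    rw [← List.length_append, h5]; simp
  have key : ∀ (u v : List L) t, (u ++ v)[u.length + t]? = v[t]? := fun u v t => by
    rw [List.getElem?_append_right (by omega), Nat.add_sub_cancel_left]
  have w1 : ∀ t, (B ++ (A ++ (A ++ (B ++ A))))[B.length + t]? = (A ++ (A ++ (B ++ A)))[t]? :=
    key _ _
  have w2 : ∀ t, (B ++ (A ++ (A ++ (B ++ A))))[B.length + A.length + t]? =
      ((A ++ B) ++ A)[t]? := fun t => by
    rw [add_assoc, w1, key, List.append_assoc]
  have w3 : ∀ t, (B ++ (A ++ (A ++ (B ++ A))))[B.length + A.length + A.length + t]? =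
      (B ++ A)[t]? := fun t => by
    rw [add_assoc, w2, List.append_assoc, key]
  have wB : ∀ t, (B ++ (A ++ (A ++ (B ++ A))))[B'.length + t]? =
      ((d :: z) ++ (A ++ (A ++ (B ++ A))))[t]? := fun t => by
    have e : ∀ R, B ++ R = B' ++ ((d :: z) ++ R) := fun R => by
      rw [← List.append_assoc, ← h2]
    rw [e, key]
  have wA : ∀ t, (B ++ (A ++ (A ++ (B ++ A))))[B.length + A'.length + t]? =
      ((c :: z) ++ (A ++ (B ++ A)))[t]? := fun t => by
    have e : ∀ R, A ++ R = A' ++ ((c :: z) ++ R) := fun R => by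
      rw [← List.append_assoc, ← h1]
    rw [add_assoc, w1, e (A ++ (B ++ A)), key]
  refine ⟨by omega, by omega, by simp; omega, by omega, fun t ht htp => ?_, fun _ => ?_,
    fun _ => ?_⟩
  · rcases lt_or_ge t B.length with hlt | hge
    · obtain ⟨e, rfl⟩ := Nat.exists_eq_add_of_le (show B'.length ≤ t by omega)
      rw [wB, show B'.length + e + A.length = B.length + A'.length + e by omega, wA,
        List.getElem?_append_left (by simp; omega), List.getElem?_append_left (by simp; omega)]
      obtain ⟨e, rfl⟩ := Nat.exists_eq_add_of_le (show 1 ≤ e by omega)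
      simp [Nat.add_comm 1]
    · obtain ⟨e, rfl⟩ := Nat.exists_eq_add_of_le hge
      rcases lt_or_ge e A.length with hlt | hge
      · rw [w1, show B.length + e + A.length = B.length + A.length + e by omega, w2,
          List.append_assoc, List.getElem?_append_left hlt, List.getElem?_append_left hlt]
      · obtain ⟨e, rfl⟩ := Nat.exists_eq_add_of_le hge
        rw [← add_assoc, w2,
          show B.length + A.length + e + A.length = B.length + A.length + A.length + e by omega, w3,
          h5, h6, List.append_assoc, List.getElem?_append_left (by omega),
          List.getElem?_append_left (by omega)]
  -- the letters before the two copies of `z` are `d` and `c`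
  · have e1 := wB 0
    have e2 := wA 0
    rw [show B'.length + 1 - 1 = B'.length + 0 by omega,
      show B'.length + 0 + A.length = B.length + A'.length + 0 by omega, e1, e2]
    simpa using h3.symm
  -- the letters after the two copies of `C` are `c'` and `d'`
  · rw [show B.length + 2 * A.length + C.length - 1 + 1 - A.length = B.length + A.length + C.length
        by omega, show B.length + 2 * A.length + C.length - 1 + 1 =
        B.length + A.length + A.length + C.length by omega, w2, w3, h5, h6]
    simpa using h7

/-- A letter `α` of `w` that is followed by at least two letters gives a run of period `ℓ k` in
`E (k + 2) w`. -/
def longWeight : Greek → List Greek → ℕ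
  | .α, _ :: _ :: _ => 1
  | _, _ => 0

/-- Since `h ^ 2` maps `α` to `αβα`, and every two letters to a word that begins with `αβα`, the
image of `α` and two more letters begins with `αβααβα`. -/
theorem E_add_two_prefix (k : ℕ) (x y : Greek) (V : List Greek) :
    ∃ S, E (k + 2) (Greek.α :: x :: y :: V) = E k [Greek.α] ++ ((E k [Greek.β] ++ (E k [Greek.α] ++
      (E k [Greek.α] ++ (E k [Greek.β] ++ E k [Greek.α])))) ++ S) := by
  have : ∃ S, h (h (Greek.α :: x :: y :: V)) =
      [Greek.α] ++
        (([Greek.β] ++ ([Greek.α] ++ ([Greek.α] ++ ([Greek.β] ++ [Greek.α])))) ++ S) := by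
    cases x <;> cases y <;> exact ⟨_, rfl⟩
  obtain ⟨S, hS⟩ := this
  refine ⟨E k S, ?_⟩
  rw [E_succ, E_succ, hS]
  simp only [E_append]

theorem E_eq_flatMap (k : ℕ) (w : List Greek) : E k w = w.flatMap fun x => E k [x] := by
  induction w with
  | nil =>
    have : ∀ k, h^[k] [] = [] := fun k => by
      induction k with
      | zero => rfl
      | succ k ih => rw [Function.iterate_succ_apply]; exact ih
    simp [E, this]
  | cons x w ih => rw [← List.singleton_append, E_append, ih]; simp

/-- The runs of period `ℓ k`: their length `7 + 2 * ℓ k + (ℓ (k + 1) - 17)` exceeds `3 * ℓ k`. -/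
theorem exists_finset_long (k : ℕ) (G : List Greek) : ∃ T : Finset (ℕ × ℕ),
    weightSum longWeight G ≤ T.card ∧
      ↑T ⊆ {q : ℕ × ℕ | IsHPRun (E (k + 2) G) q.1 q.2 ∧
        q.2 + 11 = q.1 + 2 * ℓ k + ℓ (k + 1)} := by
  refine exists_finset_weightSum_le (fun x => E (k + 2) [x]) _ 0 longWeight G fun U x V hG => ?_
  rcases x with _ | _
  swap
  · exact ⟨∅, by simp [longWeight], by simp, by simp⟩
  rcases V with _ | ⟨x, _ | ⟨y, V⟩⟩
  · exact ⟨∅, by simp [longWeight], by simp, by simp⟩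
  · exact ⟨∅, by simp [longWeight], by simp, by simp⟩
  obtain ⟨A, B, C, z, s, s', c, d, c', d', h1, h2, h3, h4, h5, h6, h7, h8⟩ := E_common k
  obtain ⟨S, hS⟩ := E_add_two_prefix k x y V
  have H := isMaxPer_of_common h1 h2 h3 h5 h6 h7
  have H' := H.append_append (u := E (k + 2) U ++ E k [Greek.α]) (w := S) (Or.inl (by omega))
    (Or.inl (by
      have := congrArg List.length h5
      simp only [List.length_append, List.length_cons] at this ⊢
      omega))
  have hw : E (k + 2) U ++ E k [Greek.α] ++ ((E k [Greek.β] ++ (E k [Greek.α] ++ (E k [Greek.α] ++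
      (E k [Greek.β] ++ E k [Greek.α])))) ++ S) = E (k + 2) G := by
    rw [hG, E_append, hS, List.append_assoc]
  rw [hw] at H'
  have lA : (E k [Greek.α]).length = ℓ k := rfl
  have lB : (E k [Greek.β]).length = B.length + 8 := by rw [h2]; simp [h4]
  have lAB : ℓ (k + 1) = ℓ k + (E k [Greek.β]).length := by
    rw [← lA, ← List.length_append, ← E_succ_α]; rfl
  have hB : 19 ≤ (E k [Greek.β]).length := by
    cases k with
    | zero => decide
    | succ k =>
      rw [E_succ_β]
      exact le_trans (by norm_num) (ℓ_pos k)
  rw [lA] at H'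
  refine ⟨{((E (k + 2) U ++ E k [Greek.α]).length + (B.length + 1),
    (E (k + 2) U ++ E k [Greek.α]).length +
      ((E k [Greek.β]).length + 2 * ℓ k + C.length - 1))}, by simp [longWeight], ?_, ?_⟩
  · rw [Finset.coe_singleton, Set.singleton_subset_iff]
    exact ⟨H'.isHPRun (by omega), by simp only; omega⟩
  · intro q hq
    rw [Finset.mem_singleton] at hq
    subst hq
    have lα : (E (k + 2) [Greek.α]).length = ℓ (k + 2) := rfl
    have := ℓ_add_two k
    simp only [← E_eq_flatMap, E_append, List.length_append, lA, lα]
    omega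

/-- All letters but the last two count. -/
theorem weightSum_longWeight_append (U : List Greek) (x y : Greek) :
    weightSum (fun x _ => match x with | .α => 1 | .β => 0) U ≤
      weightSum longWeight (U ++ [x, y]) := by
  induction U with
  | nil => simp [weightSum]
  | cons z U ih =>
    have : ∃ a b W, U ++ [x, y] = a :: b :: W := by
      rcases U with _ | ⟨a, _ | ⟨b, U⟩⟩ <;> simp
    obtain ⟨a, b, W, hW⟩ := this
    rw [hW] at ih
    cases z <;> simp only [List.cons_append, hW, weightSum, longWeight] at * <;> omega

/-- The word `h ^ m α` has `fib (m + 1)` letters `α`, and at most one of them is among the last two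
letters. -/
theorem fib_le_weightSum_longWeight (m : ℕ) :
    Nat.fib (m + 1) ≤ weightSum longWeight (h^[m] [Greek.α]) + 1 := by
  cases m with
  | zero => simp
  | succ m =>
    have hα := weightSum_iterate_h (fun x => match x with | .α => 1 | .β => 0) (m + 1)
    rcases iterate_h_succ_suffix m with ⟨U, hU⟩ | ⟨U, hU⟩
    all_goals
      have := weightSum_longWeight_append U
      rw [← hU] at hα ⊢
      rw [weightSum_append_of_const] at hα
      simp only [weightSum] at hα
      refine le_trans ?_ (Nat.add_le_add_right (this _ _) 1)
      omega

/-! ### The lower bound for the number of hp-runs -/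

/-- The hp-runs of length at most 86: those of the periods 1, 6 and 7, and for odd `n` the run of
period 26 and length 78 with which `f n` ends. -/
theorem exists_finset_short (n : ℕ) : ∃ T : Finset (ℕ × ℕ),
    10 * Nat.fib (n + 1) + 7 * Nat.fib n ≤ T.card + 1 ∧
    (n % 2 = 1 → 3 ≤ n → 10 * Nat.fib (n + 1) + 7 * Nat.fib n + 1 ≤ T.card) ∧
    ↑T ⊆ {q : ℕ × ℕ | IsHPRun (f n) q.1 q.2 ∧ q.2 < q.1 + 86} := by
  obtain ⟨T, h1, h2⟩ := exists_finset_local (h^[n] [Greek.α])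
  have h3 := weightSum_iterate_h innerWeight n
  change _ = 10 * Nat.fib (n + 1) + 7 * Nat.fib n at h3
  have h4 := weightSum_innerWeight_le (h^[n] [Greek.α])
  by_cases hn : n % 2 = 1 ∧ 3 ≤ n
  swap
  · exact ⟨T, by omega, fun a b => absurd ⟨a, b⟩ hn, fun q hq => ⟨(h2 hq).1, by
      have := (h2 hq).2; omega⟩⟩
  obtain ⟨m, rfl⟩ : ∃ m, n = 2 * m + 3 := ⟨(n - 3) / 2, by omega⟩
  obtain ⟨U, hU⟩ := iterate_h_odd_suffix m
  have h5 : weightSum (fun x _ => innerWeight x) (h^[2 * m + 3] [Greek.α]) =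
      weightSum localWeight (h^[2 * m + 3] [Greek.α]) := by
    have := weightSum_innerWeight_concat_β (U ++ [.β, .α, .α])
    rwa [List.append_assoc, List.cons_append, List.cons_append, List.cons_append, List.nil_append,
      hU] at this
  have hdec : IsMaxPer (E 0 [Greek.β, Greek.α, Greek.α, Greek.β]) 26 12 89 := by decide +kernel
  have H := (hdec.append_append (u := E 0 U) (w := []) (Or.inl (by norm_num)) (Or.inr rfl)).isHPRun
    (by omega)
  have hf : f (2 * m + 3) = E 0 U ++ (E 0 [Greek.β, Greek.α, Greek.α, Greek.β] ++ []) := by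
    rw [List.append_nil, ← E_append, hU]; rfl
  rw [← hf] at H
  have hnot : ((E 0 U).length + 12, (E 0 U).length + 89) ∉ T := fun hq => by
    have := (h2 hq).2
    simp only at this
    omega
  refine ⟨insert ((E 0 U).length + 12, (E 0 U).length + 89) T, ?_, fun _ _ => ?_, ?_⟩
  · rw [Finset.card_insert_of_notMem hnot]; omega
  · rw [Finset.card_insert_of_notMem hnot]; omega
  · rw [Finset.coe_insert]
    refine Set.insert_subset ⟨H, by simp only; omega⟩ fun q hq => ⟨(h2 hq).1, ?_⟩
    have := (h2 hq).2; omega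

/-- The runs of the periods `ℓ 0, …, ℓ (k - 1)` add `∑ i < k, (fib (n - 1 - i) - 1)` to the short
ones, from which they differ, as from one another, by their lengths. -/
theorem exists_finset_levels (n : ℕ) (T₀ : Finset (ℕ × ℕ))
    (hT₀ : ↑T₀ ⊆ {q : ℕ × ℕ | IsHPRun (f n) q.1 q.2 ∧ q.2 < q.1 + 86}) (k : ℕ) (hk : k + 1 ≤ n) :
    ∃ T : Finset (ℕ × ℕ), T₀.card + Nat.fib (n + 1) ≤ T.card + Nat.fib (n + 1 - k) + k ∧
      ↑T ⊆ {q : ℕ × ℕ | IsHPRun (f n) q.1 q.2 ∧ q.2 + 11 < q.1 + 2 * ℓ k + ℓ (k + 1)} := by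
  induction k with
  | zero =>
    refine ⟨T₀, by simp, fun q hq => ⟨(hT₀ hq).1, ?_⟩⟩
    have := (hT₀ hq).2
    rw [zero_add, ℓ_zero, ℓ_one]
    omega
  | succ k ih =>
    obtain ⟨T, h1, h2⟩ := ih (by omega)
    obtain ⟨m, rfl⟩ := Nat.exists_eq_add_of_le (show k + 2 ≤ n by omega)
    obtain ⟨T', h3, h4⟩ := exists_finset_long k (h^[m] [Greek.α])
    rw [← f_eq_E] at h4
    have h5 := fib_le_weightSum_longWeight m
    have hd : Disjoint T T' := Finset.disjoint_left.mpr fun q hq hq' => by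
      have := (h2 hq).2; have := (h4 hq').2; omega
    have e1 : k + 2 + m + 1 - k = m + 1 + 2 := by omega
    have e2 : k + 2 + m + 1 - (k + 1) = m + 2 := by omega
    rw [e1, Nat.fib_add_two] at h1
    have l1 := ℓ_le_succ k
    have l2 := ℓ_pos k
    have l3 := ℓ_add_two k
    refine ⟨T ∪ T', ?_, ?_⟩
    · rw [Finset.card_union_of_disjoint hd, e2]
      rw [show m + 1 + 1 = m + 2 by ring] at h1
      omega
    · rw [Finset.coe_union]
      refine Set.union_subset (fun q hq => ⟨(h2 hq).1, ?_⟩) fun q hq => ⟨(h4 hq).1, ?_⟩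
      · have := (h2 hq).2
        rw [show k + 1 + 1 = k + 2 by ring]; omega
      · have := (h4 hq).2
        rw [show k + 1 + 1 = k + 2 by ring]; omega

/-- The sum over all levels in closed form. The two additional runs for odd `n` are needed for
`n = 19`, where the claimed bound leaves no slack. -/
theorem r_lower_bound (n : ℕ) (hn : 1 ≤ n) :
    11 * Nat.fib (n + 1) + 7 * Nat.fib n ≤ r n + n + 1 ∧
    (n % 2 = 1 → 3 ≤ n → 11 * Nat.fib (n + 1) + 7 * Nat.fib n + 1 ≤ r n + n) := by
  obtain ⟨T₀, h1, h2, h3⟩ := exists_finset_short n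
  obtain ⟨T, h4, h5⟩ := exists_finset_levels n T₀ h3 (n - 1) (by omega)
  have h6 : T.card ≤ r n := by
    rw [← Set.ncard_coe_finset]
    exact Set.ncard_le_ncard (fun q hq => (h5 hq).1) (finite_setOf_isHPRun _)
  rw [show n + 1 - (n - 1) = 2 by omega, Nat.fib_two] at h4
  omega

/-- Both sides satisfy the Fibonacci recurrence up to the linear term, so that two initial values
suffice. The ratio of the leading terms tends to about `0.40607`; from `n = 30` on, its distance to
`0.406005` pays for the linear term. -/
theorem fib_linear_lower_bound (n : ℕ) :
    406005 * ℓ (n + 30) + 1000000 * (n + 30 + 1) ≤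
      1000000 * (11 * Nat.fib (n + 30 + 1) + 7 * Nat.fib (n + 30)) := by
  induction n using Nat.twoStepInduction with
  | zero => rw [ℓ_eq]; norm_num [Nat.fib_add_two]
  | one => rw [ℓ_eq]; norm_num [Nat.fib_add_two]
  | more n ih1 ih2 =>
    have e1 := Nat.fib_add_two (n := n + 30)
    have e2 := Nat.fib_add_two (n := n + 30 + 1)
    have e3 := ℓ_add_two (n + 30)
    rw [show n + 1 + 30 = n + 30 + 1 by ring] at ih2
    rw [show n + 30 + 1 + 1 = n + 30 + 2 by ring] at ih2 e2
    rw [show n + 2 + 30 = n + 30 + 2 by ring, show n + 30 + 2 + 1 = n + 30 + 1 + 2 by ring, e2, e3]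
    rw [e1] at ih2 ⊢
    linarith

theorem le_density (n : ℕ) : (0.406005 : ℝ) ≤ (r (n + 30) : ℝ) / ℓ (n + 30) := by
  have h1 := (r_lower_bound (n + 30) (by omega)).1
  have h2 := fib_linear_lower_bound n
  have h3 : 406005 * ℓ (n + 30) ≤ 1000000 * r (n + 30) := by omega
  have h4 : (406005 * ℓ (n + 30) : ℝ) ≤ 1000000 * r (n + 30) := by exact_mod_cast h3
  have hpos : (0 : ℝ) < ℓ (n + 30) := by have := ℓ_pos (n + 30); positivity
  rw [le_div_iff₀ hpos]
  linarith

theorem ℓ_nineteen : ℓ 19 = 255329 := by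
  rw [ℓ_eq]; norm_num [Nat.fib_add_two]

theorem le_r_nineteen : 103664 ≤ r 19 := by
  have h1 := (r_lower_bound 19 (by norm_num)).2 (by norm_num) (by norm_num)
  norm_num [Nat.fib_add_two] at h1
  omega

end HPRuns

theorem mainTheorem2 :
    (∃ L : ℝ, Tendsto (fun n : ℕ => (HPRuns.r n : ℝ) / (HPRuns.ℓ n : ℝ)) atTop (𝓝 L) ∧
      (0.406 : ℝ) < L) ∧
    (103664 / 255329 : ℝ) ≤ (HPRuns.r 19 : ℝ) / (HPRuns.ℓ 19 : ℝ) ∧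
    (0.406 : ℝ) < 103664 / 255329 := by
  refine ⟨?_, ?_, by norm_num⟩
  · obtain ⟨L, hL⟩ := HPRuns.exists_tendsto_density
    refine ⟨L, hL, lt_of_lt_of_le (by norm_num : (0.406 : ℝ) < 0.406005) ?_⟩
    exact ge_of_tendsto' (hL.comp (tendsto_add_atTop_nat 30)) HPRuns.le_density
  · rw [HPRuns.ℓ_nineteen]
    have : (103664 : ℝ) ≤ HPRuns.r 19 := by exact_mod_cast HPRuns.le_r_nineteen
    push_cast
    gcongr
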